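/- For real $\alpha>0$ let $S(\alpha)=\{(x,y)\in\mathbb R^2 : 0\le y\le \alpha x\}$, and let $S(\infty)=\{(x,y)\in\mathbb R^2 : x\ge 0,\ y\ge 0\}$. Let $0<\alpha\le\infty$ and let $P\in\mathbb R[x,y]$ be a quadratic packing polynomial on $S(\alpha)$, that is, a polynomial of total degree $2$ that maps $S(\alpha)\cap\mathbb Z^2$ bijectively onto $\mathbb N_0=\{0,1,2,\dots\}$. Then $P$ can be written in the form $$P(x,y)=A\,\frac{x(x-1)}{2}+Bxy+C\,\frac{y(y-1)}{2}+Dx+Ey+F$$ with integers $A,B,C,D,E,F$, and $$\alpha=\frac{A}{1-B}.$$ For $\alpha<\infty$ this includes that $B\neq 1$; for $\alpha=\infty$ it means that $A>0$ and $B=1$. -/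

import Mathlib

/-- The sector `S(α) = {(x, y) ∈ ℝ² | 0 ≤ y ≤ α x}`, for a real number `α > 0`. -/
def sector (α : ℝ) : Set (ℝ × ℝ) :=
  {p | 0 ≤ p.2 ∧ p.2 ≤ α * p.1}

/-- The sector `S(∞)`, the closed first quadrant. -/
def firstQuadrant : Set (ℝ × ℝ) :=
  {p | 0 ≤ p.1 ∧ 0 ≤ p.2}

/-- The integer lattice points `S ∩ ℤ²` of a plane region `S`. -/
def latticePoints (S : Set (ℝ × ℝ)) : Set (ℤ × ℤ) :=
  {p | ((p.1 : ℝ), (p.2 : ℝ)) ∈ S}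

/-- The value `P(x, y)` of a real polynomial in two variables. -/
noncomputable def polyValue (P : MvPolynomial (Fin 2) ℝ) (x y : ℝ) : ℝ :=
  MvPolynomial.eval ![x, y] P

/-- `P` is a packing polynomial on `S`: it restricts to a bijection from `S ∩ ℤ²` onto the
set of non-negative integers. -/
def IsPackingPolynomial (P : MvPolynomial (Fin 2) ℝ) (S : Set (ℝ × ℝ)) : Prop :=
  Set.BijOn (fun p : ℤ × ℤ => polyValue P (p.1 : ℝ) (p.2 : ℝ))
    (latticePoints S) (Set.range (fun n : ℕ => (n : ℝ)))

/-- `P(x, y) = A x(x-1)/2 + B x y + C y(y-1)/2 + D x + E y + F`, with integers `A, …, F`. -/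
def HasIntegerForm (P : MvPolynomial (Fin 2) ℝ) (A B C D E F : ℤ) : Prop :=
  ∀ x y : ℝ, polyValue P x y =
    A * (x * (x - 1) / 2) + B * (x * y) + C * (y * (y - 1) / 2) + D * x + E * y + F

/-!
Both regions are cones `y ≥ 0`, `x ≥ γ y`, with `γ = 1 / α` or `γ = 0`, and the claim becomes
`A γ + B = 1`, together with `A > 0`. Finite differences show that the coefficients are integers.
Write `q` for the quadratic form `A x ^ 2 + 2 B x y + C y ^ 2`.

*Positivity.* Since the values are non-negative and rational directions are dense, `q ≥ 0` on the
cone. If `q` vanished on one of the two edges, then on the `k`-th of a sequence of disjoint lattice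
strips along this edge the values would grow at most like `c (k + 1) t`; as the harmonic series
diverges, there would be more than `N + 1` values below some `N` (`IsConePacking.not_slow_growth`).
If `q` vanished inside the cone, it would be a multiple of the square of a rational linear form, and
the values on the lattice lines where this form is constant would be arithmetic progressions with
one common difference, two of which meet (`IsConePacking.neg_B_lt`). So `q > 0` on the cone.

*Degeneracy.* By positivity, values grow quadratically and the increments under a fixed translation
only linearly, so that the points with value below `N` are asymptotically equidistributed over the
residue classes of `ℤ × ℤ` modulo any `m`. As the values run through all of `ℕ`, the polynomial
modulo an odd prime `p` takes every value exactly `p` times. If `p` does not divide `A C - B ^ 2`,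
this is absurd: modulo `p` there is a centre of symmetry, and a fibre that does not contain it has
even cardinality. Hence `B ^ 2 = A C` (`IsConePacking.sq_eq_mul`). This argument needs neither
transcendence theory nor the rationality of `α`.

*Area.* Now `q = (A x + B y) ^ 2 / A`, so the points with value at most `N` are, up to lower order,
those of a triangle of area `N / (A γ + B)`. There are `N + 1` of them, whence `A γ + B = 1`
(`IsConePacking.edge_eq_one`).
-/

/-! ### Quadratic packing functions on a cone -/

/-- The lattice points of the cone `y ≥ 0`, `x ≥ γ y`. With `γ = 1 / α` these are the lattice
points of the sector `S(α)`, and `γ = 0` gives those of the first quadrant. -/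
def coneLattice (γ : ℝ) : Set (ℤ × ℤ) :=
  {p | 0 ≤ p.2 ∧ γ * p.2 ≤ p.1}

/-- The quadratic polynomial with coefficients `A, …, F` in the binomial basis. -/
noncomputable def quadVal (A B C D E F : ℤ) (x y : ℝ) : ℝ :=
  A * (x * (x - 1) / 2) + B * (x * y) + C * (y * (y - 1) / 2) + D * x + E * y + F

/-- The quadratic polynomial with coefficients `A, …, F` in the binomial basis maps the lattice
points of the cone `y ≥ 0`, `x ≥ γ y` bijectively onto the natural numbers. -/
def IsConePacking (γ : ℝ) (A B C D E F : ℤ) : Prop :=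
  Set.BijOn (fun p : ℤ × ℤ => quadVal A B C D E F (p.1 : ℝ) (p.2 : ℝ))
    (coneLattice γ) (Set.range (fun n : ℕ => (n : ℝ)))

theorem add_mem_coneLattice {γ : ℝ} {p d : ℤ × ℤ} (hp : p ∈ coneLattice γ)
    (hd : d ∈ coneLattice γ) : p + d ∈ coneLattice γ := by
  obtain ⟨h1, h2⟩ := hp
  obtain ⟨h3, h4⟩ := hd
  refine ⟨add_nonneg h1 h3, ?_⟩
  simp only [Prod.fst_add, Prod.snd_add, Int.cast_add]
  linarith

theorem nsmul_mem_coneLattice {γ : ℝ} {u v : ℤ} (hd : (u, v) ∈ coneLattice γ) (k : ℕ) :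
    ((k * u, k * v) : ℤ × ℤ) ∈ coneLattice γ := by
  obtain ⟨h3, h4⟩ := hd
  refine ⟨mul_nonneg (by positivity) h3, ?_⟩
  push_cast
  simp only at h4
  nlinarith [mul_le_mul_of_nonneg_left h4 (Nat.cast_nonneg (α := ℝ) k)]

theorem fst_nonneg_of_mem_coneLattice {γ : ℝ} (hγ : 0 ≤ γ) {p : ℤ × ℤ}
    (hp : p ∈ coneLattice γ) : (0 : ℝ) ≤ p.1 := by
  have : (0 : ℝ) ≤ p.2 := by exact_mod_cast hp.1
  exact le_trans (by positivity) hp.2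

namespace IsConePacking

variable {γ : ℝ} {A B C D E F : ℤ}

/-- The enumeration of the lattice points by their values, together with the value as a
natural number. -/
theorem exists_enum (h : IsConePacking γ A B C D E F) :
    ∃ (z : ℕ → ℤ × ℤ) (g : ℤ × ℤ → ℕ),
      (∀ n, z n ∈ coneLattice γ) ∧ (∀ n, quadVal A B C D E F (z n).1 (z n).2 = n) ∧
      (∀ p ∈ coneLattice γ, quadVal A B C D E F p.1 p.2 = g p) ∧
      (∀ p ∈ coneLattice γ, z (g p) = p) := by
  have h1 : ∀ n : ℕ, ∃ p ∈ coneLattice γ, quadVal A B C D E F (p.1 : ℝ) (p.2 : ℝ) = n :=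
    fun n => h.surjOn ⟨n, rfl⟩
  choose z hz hzn using h1
  have h2 : ∀ p : ℤ × ℤ, ∃ n : ℕ,
      p ∈ coneLattice γ → quadVal A B C D E F (p.1 : ℝ) (p.2 : ℝ) = n := by
    intro p
    by_cases hp : p ∈ coneLattice γ
    · obtain ⟨n, hn⟩ := h.mapsTo hp
      exact ⟨n, fun _ => hn.symm⟩
    · exact ⟨0, fun h' => absurd h' hp⟩
  choose g hg using h2
  refine ⟨z, g, hz, hzn, hg, fun p hp => h.injOn (hz _) hp ?_⟩
  rw [hzn, hg p hp]

theorem val_nonneg (h : IsConePacking γ A B C D E F) {p : ℤ × ℤ} (hp : p ∈ coneLattice γ) :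
    0 ≤ quadVal A B C D E F p.1 p.2 := by
  obtain ⟨n, hn⟩ := h.mapsTo hp
  exact (Nat.cast_nonneg n).trans_eq hn

/-- By injectivity at most `N + 1` lattice points have a value at most `N`. -/
theorem card_le (h : IsConePacking γ A B C D E F) (T : Finset (ℤ × ℤ))
    (hT : ∀ p ∈ T, p ∈ coneLattice γ) {N : ℝ} (hN : 0 ≤ N)
    (hTN : ∀ p ∈ T, quadVal A B C D E F p.1 p.2 ≤ N) : (T.card : ℝ) ≤ N + 1 := by
  obtain ⟨z, g, -, -, hg, hzg⟩ := h.exists_enum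
  have hc : T.card ≤ (Finset.range (⌊N⌋₊ + 1)).card := by
    refine Finset.card_le_card_of_injOn g (fun p hp => ?_) (fun p hp q hq hpq => ?_)
    · simp only [Finset.coe_range, Set.mem_Iio]
      rw [Nat.lt_succ_iff]
      apply Nat.le_floor
      rw [← hg p (hT p hp)]
      exact hTN p hp
    · rw [← hzg p (hT p hp), ← hzg q (hT q hq), hpq]
  rw [Finset.card_range] at hc
  have h1 : (T.card : ℝ) ≤ (⌊N⌋₊ : ℝ) + 1 := by exact_mod_cast hc
  linarith [Nat.floor_le hN]

/-! ### Positivity of the quadratic form on the cone -/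

/-- The values along a lattice ray stay non-negative, so its direction has a non-negative
leading coefficient. -/
theorem form_nonneg (h : IsConePacking γ A B C D E F) {u v : ℤ}
    (hd : (u, v) ∈ coneLattice γ) : (0 : ℝ) ≤ A * u ^ 2 + 2 * B * u * v + C * v ^ 2 := by
  by_contra! hneg
  have h1 : (A : ℝ) * u ^ 2 + 2 * B * u * v + C * v ^ 2 ≤ -1 := by
    have : A * u ^ 2 + 2 * B * u * v + C * v ^ 2 < 0 := by exact_mod_cast hneg
    have : A * u ^ 2 + 2 * B * u * v + C * v ^ 2 ≤ -1 := by omega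
    exact_mod_cast this
  set l : ℝ := (2 * D - A) * u + (2 * E - C) * v with hl
  obtain ⟨k, hk⟩ := exists_nat_gt (|l| + 2 * |(F : ℝ)| + 1)
  have h2 := h.val_nonneg (nsmul_mem_coneLattice hd k)
  have h3 : 2 * quadVal A B C D E F ((k * u : ℤ) : ℝ) ((k * v : ℤ) : ℝ)
      = k ^ 2 * ((A : ℝ) * u ^ 2 + 2 * B * u * v + C * v ^ 2) + k * l + 2 * F := by
    simp only [quadVal, hl]
    push_cast
    ring
  simp only at h2
  have hk0 : (0 : ℝ) ≤ k := Nat.cast_nonneg k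
  have hk1 : (1 : ℝ) ≤ k := by
    have := abs_nonneg l; have := abs_nonneg (F : ℝ); linarith
  have h4 : (k : ℝ) ^ 2 * ((A : ℝ) * u ^ 2 + 2 * B * u * v + C * v ^ 2) ≤ k ^ 2 * (-1) :=
    mul_le_mul_of_nonneg_left h1 (by positivity)
  have h5 : (k : ℝ) * l ≤ k * |l| := mul_le_mul_of_nonneg_left (le_abs_self l) hk0
  have h6 := mul_le_mul_of_nonneg_left hk.le hk0
  have h7 : 2 * |(F : ℝ)| ≤ k * (2 * |(F : ℝ)|) :=
    le_mul_of_one_le_left (by positivity) hk1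
  have := le_abs_self (F : ℝ)
  nlinarith

/-- Rational directions are dense in the cone, so the quadratic form is non-negative on it. -/
theorem slope_nonneg (h : IsConePacking γ A B C D E F) {t : ℝ} (ht : γ ≤ t) :
    0 ≤ A * t ^ 2 + 2 * B * t + C := by
  by_contra! hneg
  have hcont : Continuous fun t : ℝ => A * t ^ 2 + 2 * B * t + C := by fun_prop
  have hev := hcont.continuousAt.eventually (gt_mem_nhds hneg)
  obtain ⟨δ, hδ, hball⟩ := Metric.eventually_nhds_iff.mp hev
  obtain ⟨r, hr1, hr2⟩ := exists_rat_btwn (show t < t + δ by linarith)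
  have hr := hball (y := (r : ℝ)) (by rw [Real.dist_eq, abs_lt]; constructor <;> linarith)
  have hden : (0 : ℝ) < r.den := by exact_mod_cast r.den_pos
  have hrr : (r : ℝ) * r.den = r.num := by exact_mod_cast Rat.mul_den_eq_num r
  have hmem : (r.num, (r.den : ℤ)) ∈ coneLattice γ := by
    refine ⟨by positivity, ?_⟩
    simp only [Int.cast_natCast]
    rw [← hrr]
    exact mul_le_mul_of_nonneg_right (by linarith) hden.le
  have h1 := h.form_nonneg hmem
  rw [← hrr] at h1
  push_cast at h1
  have h2 : (A : ℝ) * (r * r.den) ^ 2 + 2 * B * (r * r.den) * r.den + C * r.den ^ 2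
      = (A * (r : ℝ) ^ 2 + 2 * B * r + C) * r.den ^ 2 := by ring
  rw [h2] at h1
  have := mul_neg_of_neg_of_pos hr (by positivity : (0 : ℝ) < (r.den : ℝ) ^ 2)
  linarith

/-- Along the `k`-th of infinitely many disjoint sequences of lattice points the values cannot
grow as slowly as `c (k + 1) t`: below `N` there would be about `∑ k, N / (c (k + 1))` values,
and the harmonic series diverges. -/
theorem not_slow_growth (h : IsConePacking γ A B C D E F) (s : ℕ → ℕ → ℤ × ℤ)
    (hs : ∀ k t, s k t ∈ coneLattice γ)
    (hinj : ∀ k t k' t', s k t = s k' t' → k = k' ∧ t = t') {c : ℝ} (hc : 0 < c) (d : ℕ → ℝ)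
    (hle : ∀ k t : ℕ,
      quadVal A B C D E F (s k t).1 (s k t).2 ≤ c * (k + 1) * t + d k) : False := by
  obtain ⟨K, hK⟩ := (Real.tendsto_sum_range_one_div_nat_succ_atTop.eventually_gt_atTop
    (2 * c)).exists
  set M : ℝ := ∑ k ∈ Finset.range K, (d k / (c * (k + 1)) + 1) with hM
  obtain ⟨N, hN⟩ := exists_nat_gt (M + 1)
  set m : ℕ → ℕ := fun k => ⌊((N : ℝ) - d k) / (c * (k + 1))⌋₊ with hm
  set T : Finset (Σ _ : ℕ, ℕ) := (Finset.range K).sigma fun k => Finset.Icc 1 (m k) with hT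
  have hcard : T.card = ∑ k ∈ Finset.range K, m k := by
    rw [hT, Finset.card_sigma]
    simp
  have himg : (T.image fun x => s x.1 x.2).card = T.card := by
    refine Finset.card_image_of_injective _ fun x y hxy => ?_
    obtain ⟨h1, h2⟩ := hinj _ _ _ _ hxy
    cases x; cases y
    simp only at h1 h2
    subst h1; subst h2; rfl
  have hbound := h.card_le (T.image fun x => s x.1 x.2) (by
      intro p hp
      obtain ⟨x, _, rfl⟩ := Finset.mem_image.mp hp
      exact hs _ _) (Nat.cast_nonneg N) (by
      intro p hp
      obtain ⟨⟨k, t⟩, hx, rfl⟩ := Finset.mem_image.mp hp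
      rw [hT, Finset.mem_sigma, Finset.mem_Icc] at hx
      obtain ⟨_, h1, h2⟩ := hx
      have hpos : 0 < c * ((k : ℝ) + 1) := by positivity
      have h3 : (t : ℝ) ≤ ((N : ℝ) - d k) / (c * (k + 1)) := by
        simp only [hm] at h1 h2
        exact (Nat.le_floor_iff' (by omega)).mp h2
      rw [le_div_iff₀ hpos] at h3
      have := hle k t
      simp only
      linarith)
  rw [himg, hcard] at hbound
  have hlow : (N : ℝ) / c * ∑ k ∈ Finset.range K, 1 / ((k : ℝ) + 1) - M
      ≤ ((∑ k ∈ Finset.range K, m k : ℕ) : ℝ) := by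
    rw [hM, Finset.mul_sum, ← Finset.sum_sub_distrib, Nat.cast_sum]
    refine Finset.sum_le_sum fun k _ => ?_
    have h1 := Nat.lt_floor_add_one (((N : ℝ) - d k) / (c * (k + 1)))
    have h2 : (N : ℝ) / c * (1 / ((k : ℝ) + 1)) - (d k / (c * (k + 1)) + 1)
        = ((N : ℝ) - d k) / (c * (k + 1)) - 1 := by
      have : (k : ℝ) + 1 ≠ 0 := by positivity
      field_simp
      ring
    rw [h2]
    simp only [hm]
    linarith
  have h3 : (N : ℝ) / c * (2 * c) ≤ (N : ℝ) / c * ∑ k ∈ Finset.range K, 1 / ((k : ℝ) + 1) :=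
    mul_le_mul_of_nonneg_left hK.le (by positivity)
  have h4 : (N : ℝ) / c * (2 * c) = 2 * N := by field_simp
  linarith

/-- The quadratic form does not vanish on the edge `y = 0`. -/
theorem A_ne_zero (h : IsConePacking γ A B C D E F) : A ≠ 0 := by
  intro hA
  refine h.not_slow_growth (fun k t => ((⌈γ * k⌉ + t : ℤ), (k : ℤ))) (fun k t => ⟨by positivity, ?_⟩)
    (fun k t k' t' hk => ?_) (c := |(B : ℝ)| + |(D : ℝ)| + 1) (by positivity)
    (fun k => (B * k + D) * ⌈γ * k⌉ + C * ((k : ℝ) * (k - 1) / 2) + E * k + F) (fun k t => ?_)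
  · push_cast
    have := Int.le_ceil (γ * k)
    have : (0 : ℝ) ≤ t := Nat.cast_nonneg t
    linarith
  · simp only [Prod.mk.injEq] at hk
    obtain ⟨h1, h2⟩ := hk
    have h2' : k = k' := by exact_mod_cast h2
    subst h2'
    exact ⟨rfl, by omega⟩
  · have h1 : ((B : ℝ) * k + D) * t ≤ (|(B : ℝ)| + |(D : ℝ)| + 1) * (k + 1) * t := by
      refine mul_le_mul_of_nonneg_right ?_ (Nat.cast_nonneg t)
      have hk : (0 : ℝ) ≤ k := Nat.cast_nonneg k
      nlinarith [mul_le_mul_of_nonneg_right (le_abs_self (B : ℝ)) hk, le_abs_self (D : ℝ),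
        abs_nonneg (B : ℝ), mul_nonneg (abs_nonneg (D : ℝ)) hk]
    simp only [quadVal, hA]
    push_cast
    linarith

theorem A_pos (h : IsConePacking γ A B C D E F) : 0 < A := by
  have h1 := h.form_nonneg (u := 1) (v := 0) ⟨le_rfl, by simp⟩
  have h2 : (0 : ℤ) ≤ A := by
    have : (0 : ℝ) ≤ A := by simpa using h1
    exact_mod_cast this
  exact lt_of_le_of_ne h2 h.A_ne_zero.symm

/-- The quadratic form does not vanish on the edge `x = γ y`. The points at distance about `k`
from that edge form the `k`-th sequence; this needs no rationality of `γ`. -/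
theorem edge_ne_zero (h : IsConePacking γ A B C D E F) (hγ : 0 ≤ γ) :
    (A : ℝ) * γ ^ 2 + 2 * B * γ + C ≠ 0 := by
  intro hq
  set c₁ : ℝ := A * γ + B with hc₁
  set c₂ : ℝ := D - A / 2 with hc₂
  set c₃ : ℝ := E - C / 2 with hc₃
  refine h.not_slow_growth (fun k t => ((⌈γ * t⌉ + k : ℤ), (t : ℤ))) (fun k t => ⟨by positivity, ?_⟩)
    (fun k t k' t' hk => ?_) (c := |c₁| + |c₂| * γ + |c₃| + 1) (by positivity)
    (fun k => |(A : ℝ)| / 2 * (k + 1) ^ 2 + |c₂| * (k + 1) + F) (fun k t => ?_)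
  · push_cast
    have := Int.le_ceil (γ * t)
    have : (0 : ℝ) ≤ k := Nat.cast_nonneg k
    linarith
  · simp only [Prod.mk.injEq] at hk
    obtain ⟨h1, h2⟩ := hk
    have h2' : t = t' := by exact_mod_cast h2
    subst h2'
    exact ⟨by omega, rfl⟩
  · have hk : (0 : ℝ) ≤ k := Nat.cast_nonneg k
    have ht : (0 : ℝ) ≤ t := Nat.cast_nonneg t
    obtain ⟨s, hs⟩ : ∃ s : ℝ, s = ⌈γ * t⌉ + k - γ * t := ⟨_, rfl⟩
    have hs0 : 0 ≤ s := by linarith [Int.le_ceil (γ * t)]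
    have hs1 : s ≤ k + 1 := by linarith [Int.ceil_lt_add_one (γ * t)]
    have hval : quadVal A B C D E F ((⌈γ * t⌉ + k : ℤ) : ℝ) ((t : ℤ) : ℝ)
        = c₁ * s * t + A / 2 * s ^ 2 + c₂ * (γ * t) + c₂ * s + c₃ * t + F := by
      have : (((⌈γ * t⌉ + k : ℤ) : ℝ)) = γ * t + s := by push_cast; linarith
      rw [this]
      simp only [quadVal, hc₁, hc₂, hc₃]
      push_cast
      linear_combination ((t : ℝ) ^ 2 / 2) * hq
    have e1 : c₁ * s * t ≤ |c₁| * (k + 1) * t :=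
      mul_le_mul_of_nonneg_right (mul_le_mul (le_abs_self _) hs1 hs0 (abs_nonneg _)) ht
    have e2 : (A : ℝ) / 2 * s ^ 2 ≤ |(A : ℝ)| / 2 * (k + 1) ^ 2 :=
      mul_le_mul (by linarith [le_abs_self (A : ℝ)]) (pow_le_pow_left₀ hs0 hs1 2)
        (by positivity) (by positivity)
    have e3 : c₂ * (γ * t) ≤ |c₂| * (γ * t) :=
      mul_le_mul_of_nonneg_right (le_abs_self _) (by positivity)
    have e4 : c₂ * s ≤ |c₂| * (k + 1) := mul_le_mul (le_abs_self _) hs1 hs0 (abs_nonneg _)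
    have e5 : c₃ * t ≤ |c₃| * t := mul_le_mul_of_nonneg_right (le_abs_self _) ht
    have e6 : 0 ≤ (|c₂| * γ + |c₃|) * k * t + (k + 1) * t := by positivity
    simp only
    rw [hval]
    nlinarith

/-- If the form is a square of a linear form, then its kernel direction `(-B, A)` lies outside
the cone. Otherwise all lattice lines of this direction carry arithmetic progressions of values
with one common difference `σ`, and two of the first `σ + 1` of them meet. -/
theorem neg_B_lt (h : IsConePacking γ A B C D E F) (hΔ : B ^ 2 = A * C) :
    -(B : ℝ) < γ * A := by
  by_contra! hB
  have hA := h.A_pos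
  obtain ⟨z, g, -, -, hg, hzg⟩ := h.exists_enum
  -- the factor 2 makes the common difference an integer
  set σ : ℤ := -2 * B * D + 2 * A * E + A * B - A * C with hσ
  have hΔ' : (B : ℝ) ^ 2 = A * C := by exact_mod_cast hΔ
  have hmem : ∀ j t : ℕ, ((j - 2 * t * B, 2 * t * A) : ℤ × ℤ) ∈ coneLattice γ := by
    intro j t
    refine ⟨by positivity, ?_⟩
    push_cast
    have ht : (0 : ℝ) ≤ t := Nat.cast_nonneg t
    have hj : (0 : ℝ) ≤ j := Nat.cast_nonneg j
    nlinarith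
  have hval : ∀ j t : ℕ, (g (j - 2 * t * B, 2 * t * A) : ℤ) = g (j, 0) + t * σ := by
    intro j t
    have h1 := hg _ (hmem j t)
    have h2 := hg _ (by simpa using hmem j 0 : ((j, 0) : ℤ × ℤ) ∈ coneLattice γ)
    have h3 : (g (j - 2 * t * B, 2 * t * A) : ℝ) = g (j, 0) + t * σ := by
      rw [← h1, ← h2, hσ]
      simp only [quadVal]
      push_cast
      linear_combination (-2 * (A : ℝ) * t ^ 2) * hΔ'
    exact_mod_cast h3
  have hinj : ∀ i j t : ℕ, (g (j - 2 * t * B, 2 * t * A) : ℤ) = g (i, 0) → t = 0 ∧ i = j := by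
    intro i j t hij
    have h1 := hzg _ (hmem j t)
    have h2 := hzg _ (by simpa using hmem i 0 : ((i, 0) : ℤ × ℤ) ∈ coneLattice γ)
    have h3 : g (j - 2 * t * B, 2 * t * A) = g (i, 0) := by exact_mod_cast hij
    rw [h3, h2, Prod.mk.injEq] at h1
    obtain ⟨h4, h5⟩ := h1
    have ht : t = 0 := by
      have : (2 : ℤ) * t * A = 0 := h5.symm
      simpa [hA.ne'] using this
    subst ht
    exact ⟨rfl, by simpa using h4⟩
  have hσ0 : 0 < σ := by
    by_contra! hneg
    rcases hneg.lt_or_eq with hneg | hzero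
    · have h1 := hval 0 (g (0, 0) + 1)
      push_cast at h1
      have h2 : (0 : ℤ) ≤ g ((0 : ℕ) - 2 * ((g (0, 0) + 1 : ℕ) : ℤ) * B,
        2 * ((g (0, 0) + 1 : ℕ) : ℤ) * A) := by positivity
      push_cast at h2
      nlinarith [(Nat.cast_nonneg (g (0, 0)) : (0 : ℤ) ≤ (g (0, 0) : ℤ))]
    · have h1 := hval 0 1
      rw [hzero, mul_zero, add_zero] at h1
      exact one_ne_zero (hinj 0 0 1 h1).1
  obtain ⟨m, hm⟩ := Int.eq_ofNat_of_zero_le hσ0.le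
  have hm0 : NeZero m := ⟨by rintro rfl; simp [hm] at hσ0⟩
  obtain ⟨i, j, hij, hmod⟩ :=
    Finite.exists_ne_map_eq_of_infinite (fun j : ℕ => ((g (j, 0) : ℕ) : ZMod m))
  simp only [ZMod.natCast_eq_natCast_iff] at hmod
  have key : ∀ i j : ℕ, g (j, 0) ≤ g (i, 0) → g (j, 0) ≡ g (i, 0) [MOD m] → i = j := by
    intro i j hle hmod
    obtain ⟨t, ht⟩ := (Nat.modEq_iff_dvd' hle).mp hmod
    refine (hinj i j t ?_).2
    rw [hval, hm]
    have : g (i, 0) = g (j, 0) + m * t := by omega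
    rw [this]
    push_cast
    ring
  rcases le_total (g (j, 0)) (g (i, 0)) with hle | hle
  · exact hij (key i j hle hmod.symm)
  · exact hij (key j i hle hmod).symm

/-- The quadratic form is positive on the closed cone. At a zero inside the cone it would have a
minimum, so it would be a square vanishing in the kernel direction. -/
theorem slope_pos (h : IsConePacking γ A B C D E F) (hγ : 0 ≤ γ) {t : ℝ} (ht : γ ≤ t) :
    0 < A * t ^ 2 + 2 * B * t + C := by
  refine lt_of_le_of_ne (h.slope_nonneg ht) fun hzero => ?_
  have htγ : γ < t := lt_of_le_of_ne ht fun he => h.edge_ne_zero hγ (by rw [he]; exact hzero.symm)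
  have hder : (A : ℝ) * t + B = 0 := by
    by_contra hne
    have hmin : IsLocalMin (fun t : ℝ => A * t ^ 2 + 2 * B * t + C) t := by
      filter_upwards [lt_mem_nhds htγ] with s hs
      rw [← hzero]
      exact h.slope_nonneg hs.le
    have hd : HasDerivAt (fun t : ℝ => A * t ^ 2 + 2 * B * t + C) (2 * (A * t + B)) t := by
      have := (((hasDerivAt_pow 2 t).const_mul (A : ℝ)).add
        ((hasDerivAt_id' t).const_mul (2 * (B : ℝ)))).add_const (C : ℝ)
      exact this.congr_deriv (by norm_num; ring)
    have := hmin.hasDerivAt_eq_zero hd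
    exact hne (by linarith)
  have hΔ : B ^ 2 = A * C := by
    have : (B : ℝ) ^ 2 = A * C := by
      linear_combination (A * t + B) * hder + A * hzero
    exact_mod_cast this
  have hA : (0 : ℝ) < A := by exact_mod_cast h.A_pos
  have := h.neg_B_lt hΔ
  nlinarith

/-! ### Growth and small increments -/

theorem exists_form_lower_bound (h : IsConePacking γ A B C D E F) (hγ : 0 ≤ γ) :
    ∃ c : ℝ, 0 < c ∧ ∀ x y : ℝ, 0 ≤ y → γ * y ≤ x →
      c * (x + y) ^ 2 ≤ A * x ^ 2 + 2 * B * x * y + C * y ^ 2 := by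
  have hA : (0 : ℝ) < A := by exact_mod_cast h.A_pos
  set u : ℝ → ℝ := fun y => A * (1 - y) ^ 2 + 2 * B * (1 - y) * y + C * y ^ 2 with hu
  have hcont : Continuous u := by fun_prop
  have hγ1 : 0 < 1 + γ := by linarith
  obtain ⟨y₀, ⟨hy0, hy1⟩, hmin⟩ := (isCompact_Icc (a := (0 : ℝ)) (b := 1 / (1 + γ))).exists_isMinOn
    ⟨0, le_rfl, by positivity⟩ hcont.continuousOn
  refine ⟨u y₀, ?_, fun x y hy hx => ?_⟩
  · rcases hy0.eq_or_lt with he | hpos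
    · simpa [hu, ← he] using hA
    · rw [le_div_iff₀ hγ1] at hy1
      have ht : γ ≤ (1 - y₀) / y₀ := by
        rw [le_div_iff₀ hpos]
        linarith
      have h1 := mul_pos (h.slope_pos hγ ht) (pow_pos hpos 2)
      have h2 : (A * ((1 - y₀) / y₀) ^ 2 + 2 * B * ((1 - y₀) / y₀) + C) * y₀ ^ 2 = u y₀ := by
        simp only [hu]
        field_simp
      rwa [h2] at h1
  · have hx0 : 0 ≤ x := le_trans (by positivity) hx
    rcases (add_nonneg hx0 hy).eq_or_lt with he | hs
    · have hx' : x = 0 := by linarith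
      have hy' : y = 0 := by linarith
      simp [hx', hy']
    · have h1 := isMinOn_iff.mp hmin (y / (x + y)) ⟨by positivity, by
        rw [div_le_div_iff₀ hs hγ1]
        linarith⟩
      have h2 := mul_le_mul_of_nonneg_right h1 (sq_nonneg (x + y))
      have h3 : u (y / (x + y)) * (x + y) ^ 2 = A * x ^ 2 + 2 * B * x * y + C * y ^ 2 := by
        have : 1 - y / (x + y) = x / (x + y) := by
          field_simp
          ring
        simp only [hu, this]
        field_simp
      linarith

/-- Values grow quadratically and increments only linearly, so a step by a fixed vector of the
cone increases a value by a small fraction of itself, up to a constant. -/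
theorem exists_val_add_le (h : IsConePacking γ A B C D E F) (hγ : 0 ≤ γ) (d : ℤ × ℤ)
    {ε : ℝ} (hε : 0 < ε) :
    ∃ K : ℝ, 0 ≤ K ∧ ∀ p ∈ coneLattice γ,
      quadVal A B C D E F (p + d).1 (p + d).2
        ≤ quadVal A B C D E F p.1 p.2 + (ε * quadVal A B C D E F p.1 p.2 + K) := by
  obtain ⟨c, hc, hform⟩ := h.exists_form_lower_bound hγ
  obtain ⟨u, v⟩ := d
  set k₁ : ℝ := |(A : ℝ) * u + B * v| + |(B : ℝ) * u + C * v| with hk₁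
  set k₀ : ℝ := |quadVal A B C D E F u v - F| with hk₀
  set l : ℝ := |(D : ℝ) - A / 2| + |(E : ℝ) - C / 2| with hl
  refine ⟨k₀ + ε * |(F : ℝ)| + (k₁ + ε * l) ^ 2 / (2 * ε * c), by positivity, fun p hp => ?_⟩
  have hx : (0 : ℝ) ≤ p.1 := fst_nonneg_of_mem_coneLattice hγ hp
  have hy : (0 : ℝ) ≤ p.2 := by exact_mod_cast hp.1
  have hF := hform p.1 p.2 hy hp.2
  set x : ℝ := (p.1 : ℝ) with hxdef
  set y : ℝ := (p.2 : ℝ) with hydef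
  have hinc : quadVal A B C D E F (p + (u, v)).1 (p + (u, v)).2 - quadVal A B C D E F x y
      ≤ k₁ * (x + y) + k₀ := by
    have h1 : quadVal A B C D E F (p + (u, v)).1 (p + (u, v)).2 - quadVal A B C D E F x y
        = ((A : ℝ) * u + B * v) * x + ((B : ℝ) * u + C * v) * y
          + (quadVal A B C D E F u v - F) := by
      simp only [quadVal, Prod.fst_add, Prod.snd_add, Int.cast_add]
      ring
    rw [h1]
    have e1 := mul_le_mul_of_nonneg_right (le_abs_self ((A : ℝ) * u + B * v)) hx
    have e2 := mul_le_mul_of_nonneg_right (le_abs_self ((B : ℝ) * u + C * v)) hy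
    have e3 := le_abs_self (quadVal A B C D E F u v - F)
    have e4 : 0 ≤ |(A : ℝ) * u + B * v| * y := by positivity
    have e5 : 0 ≤ |(B : ℝ) * u + C * v| * x := by positivity
    rw [hk₁]
    linarith
  have hlow : c / 2 * (x + y) ^ 2 - l * (x + y) - |(F : ℝ)| ≤ quadVal A B C D E F x y := by
    have e1 := mul_le_mul_of_nonneg_right (neg_abs_le ((D : ℝ) - A / 2)) hx
    have e2 := mul_le_mul_of_nonneg_right (neg_abs_le ((E : ℝ) - C / 2)) hy
    have e3 := neg_abs_le (F : ℝ)
    have e4 : 0 ≤ |(D : ℝ) - A / 2| * y := by positivity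
    have e5 : 0 ≤ |(E : ℝ) - C / 2| * x := by positivity
    rw [hl]
    simp only [quadVal]
    linarith
  have hamgm : (k₁ + ε * l) * (x + y)
      ≤ ε * (c / 2) * (x + y) ^ 2 + (k₁ + ε * l) ^ 2 / (2 * ε * c) := by
    have hε2 : 0 < 2 * ε * c := by positivity
    have h1 : ε * (c / 2) * (x + y) ^ 2 + (k₁ + ε * l) ^ 2 / (2 * ε * c)
        - (k₁ + ε * l) * (x + y) = (ε * c * (x + y) - (k₁ + ε * l)) ^ 2 / (2 * ε * c) := by
      field_simp
      ring
    have h2 : 0 ≤ (ε * c * (x + y) - (k₁ + ε * l)) ^ 2 / (2 * ε * c) := by positivity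
    linarith
  have h5 := mul_le_mul_of_nonneg_left hlow hε.le
  nlinarith

/-! ### Residue classes modulo a prime and the discriminant -/

/-- The values below `N` are asymptotically shared equally between the residue classes of the
lattice points modulo `m`: a translation carries one class into the other and moves few values
across `N`. -/
theorem exists_card_class_le (h : IsConePacking γ A B C D E F) (hγ : 0 ≤ γ)
    {z : ℕ → ℤ × ℤ} (hz : ∀ n, z n ∈ coneLattice γ)
    (hzn : ∀ n, quadVal A B C D E F (z n).1 (z n).2 = n)
    (m : ℕ) [NeZero m] (a b : ZMod m × ZMod m) {ε : ℝ} (hε : 0 < ε) :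
    ∃ K : ℝ, 0 ≤ K ∧ ∀ N : ℕ,
      ((Finset.range N).filter fun n => (((z n).1 : ZMod m), ((z n).2 : ZMod m)) = a).card
        ≤ (((Finset.range N).filter fun n =>
            (((z n).1 : ZMod m), ((z n).2 : ZMod m)) = b).card : ℝ) + (ε * N + K) := by
  set v : ℕ := (b.2 - a.2).val with hv
  set u : ℕ := (b.1 - a.1).val + m * ⌈γ * v⌉₊ with hu
  have hd : ((u, v) : ℤ × ℤ) ∈ coneLattice γ := by
    refine ⟨by positivity, ?_⟩
    have h1 := Nat.le_ceil (γ * v)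
    have h2 : ⌈γ * v⌉₊ ≤ u := by
      have : 1 * ⌈γ * v⌉₊ ≤ m * ⌈γ * v⌉₊ := Nat.mul_le_mul_right _ (Nat.pos_of_neZero m)
      omega
    have h3 : (⌈γ * v⌉₊ : ℝ) ≤ u := by exact_mod_cast h2
    push_cast
    linarith
  have hu' : ((u : ℤ) : ZMod m) = b.1 - a.1 := by simp [hu]
  have hv' : ((v : ℤ) : ZMod m) = b.2 - a.2 := by simp [hv]
  obtain ⟨K, hK, hle⟩ := h.exists_val_add_le hγ ((u : ℤ), (v : ℤ)) hε
  obtain ⟨-, g, -, -, hg, -⟩ := h.exists_enum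
  have hzg : ∀ p ∈ coneLattice γ, z (g p) = p := fun p hp => h.injOn (hz _) hp (by rw [hzn, hg p hp])
  refine ⟨K + 1, by linarith, fun N => ?_⟩
  set M : ℕ := ⌈ε * N + K⌉₊ with hM
  have hmem : ∀ n, z n + ((u : ℤ), (v : ℤ)) ∈ coneLattice γ := fun n => add_mem_coneLattice (hz n) hd
  have h1 : ((Finset.range N).filter fun n =>
        (((z n).1 : ZMod m), ((z n).2 : ZMod m)) = a).card
      ≤ ((Finset.range (N + M)).filter fun n =>
        (((z n).1 : ZMod m), ((z n).2 : ZMod m)) = b).card := by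
    refine Finset.card_le_card_of_injOn (fun n => g (z n + ((u : ℤ), (v : ℤ)))) (fun n hn => ?_)
      (fun n hn n' hn' hnn => ?_)
    · simp only [Finset.coe_filter, Finset.mem_range, Set.mem_ofPred_eq] at hn ⊢
      rw [hzg _ (hmem n)]
      constructor
      · have h2 := hle _ (hz n)
        rw [hg _ (hmem n), hzn] at h2
        have h3 : (n : ℝ) < N := by exact_mod_cast hn.1
        have h4 := Nat.le_ceil (ε * N + K)
        have h5 := mul_lt_mul_of_pos_left h3 hε
        have : (g (z n + ((u : ℤ), (v : ℤ))) : ℝ) < ((N + M : ℕ) : ℝ) := by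
          push_cast
          rw [hM]
          linarith
        exact_mod_cast this
      · have h3 : a.1 = ((z n).1 : ZMod m) := by rw [← hn.2]
        have h4 : a.2 = ((z n).2 : ZMod m) := by rw [← hn.2]
        ext
        · rw [Prod.fst_add, Int.cast_add, hu', h3]
          ring
        · rw [Prod.snd_add, Int.cast_add, hv', h4]
          ring
    · have h2 := hzg _ (hmem n)
      simp only at hnn
      rw [hnn, hzg _ (hmem n')] at h2
      have h3 := add_right_cancel h2
      have h4 := hzn n
      rw [← h3, hzn n'] at h4
      exact_mod_cast h4.symm
  have h2 : ((Finset.range (N + M)).filter fun n =>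
        (((z n).1 : ZMod m), ((z n).2 : ZMod m)) = b).card
      ≤ ((Finset.range N).filter fun n =>
        (((z n).1 : ZMod m), ((z n).2 : ZMod m)) = b).card + M := by
    calc _ ≤ (((Finset.range N).filter fun n =>
        (((z n).1 : ZMod m), ((z n).2 : ZMod m)) = b) ∪ Finset.Ico N (N + M)).card := by
          refine Finset.card_le_card fun n hn => ?_
          simp only [Finset.mem_filter, Finset.mem_range, Finset.mem_union,
            Finset.mem_Ico] at hn ⊢
          by_cases hnN : n < N
          · exact Or.inl ⟨hnN, hn.2⟩
          · exact Or.inr ⟨by omega, hn.1⟩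
      _ ≤ _ := by
          refine (Finset.card_union_le _ _).trans ?_
          simp
  have h3 : (((Finset.range N).filter fun n =>
        (((z n).1 : ZMod m), ((z n).2 : ZMod m)) = a).card : ℝ)
      ≤ ((Finset.range N).filter fun n =>
        (((z n).1 : ZMod m), ((z n).2 : ZMod m)) = b).card + M := by
    exact_mod_cast h1.trans h2
  have h4 := Nat.ceil_lt_add_one (show 0 ≤ ε * N + K by positivity)
  linarith

end IsConePacking

/-- A fixed-point-free involution of a finite set makes its cardinality even. -/
theorem even_card_of_involution {α : Type*} (s : Finset α) (φ : α → α)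
    (hs : ∀ a ∈ s, φ a ∈ s) (hφ : ∀ a, φ (φ a) = a) (hne : ∀ a ∈ s, φ a ≠ a) :
    Even s.card := by
  have h : ∑ _a ∈ s, (1 : ZMod 2) = 0 :=
    Finset.sum_involution (fun a _ => φ a) (fun _ _ => by decide) (fun a ha _ => hne a ha)
      (fun a ha => hs a ha) (fun a _ => hφ a)
  rw [Finset.sum_const, nsmul_one, ZMod.natCast_eq_zero_iff] at h
  exact even_iff_two_dvd.mpr h

theorem card_range_mul_filter_cast_eq {p : ℕ} [NeZero p] (r : ZMod p) (k : ℕ) :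
    ((Finset.range (p * k)).filter fun n : ℕ => (n : ZMod p) = r).card = k := by
  have h : ((Finset.range (p * k)).filter fun n : ℕ => n ≡ r.val [MOD p]).card = k := by
    rw [← Nat.count_eq_card_filter_range, Nat.count_modEq_card _ (Nat.pos_of_neZero p)]
    simp [Nat.mul_div_cancel_left _ (Nat.pos_of_neZero p)]
  refine Eq.trans (congrArg Finset.card (Finset.filter_congr fun n _ => ?_)) h
  rw [← ZMod.natCast_eq_natCast_iff, ZMod.natCast_zmod_val]

theorem nonpos_of_forall_mul_sq_le {a b c : ℝ} {n₀ : ℕ}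
    (h : ∀ n : ℕ, n₀ ≤ n → a * n ^ 2 ≤ b * n + c) : a ≤ 0 := by
  by_contra! ha
  obtain ⟨m, hm⟩ := exists_nat_gt ((|b| + |c|) / a)
  have h1 := h (m + n₀ + 1) (by omega)
  set n : ℝ := ((m + n₀ + 1 : ℕ) : ℝ) with hn
  have hn1 : (m : ℝ) ≤ n := by
    rw [hn]
    exact_mod_cast (by omega : m ≤ m + n₀ + 1)
  have hn2 : (1 : ℝ) ≤ n := by
    rw [hn]
    exact_mod_cast (by omega : 1 ≤ m + n₀ + 1)
  rw [div_lt_iff₀ ha] at hm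
  have h2 : (|b| + |c|) * n < n * a * n := by
    refine mul_lt_mul_of_pos_right ?_ (by linarith)
    exact hm.trans_le (mul_le_mul_of_nonneg_right hn1 ha.le)
  have h3 : b * n ≤ |b| * n := mul_le_mul_of_nonneg_right (le_abs_self b) (by linarith)
  have h4 : |c| ≤ |c| * n := le_mul_of_one_le_right (abs_nonneg c) hn2
  linarith [le_abs_self c]

namespace IsConePacking

variable {γ : ℝ} {A B C D E F : ℤ}

/-- The quadratic form is degenerate. Otherwise let `p` be an odd prime not dividing
`A C - B ^ 2`. Equidistribution forces every fibre of the polynomial modulo `p` to have exactly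
`p` elements. But modulo `p` the conic has a centre, and the point reflection in it shows that
every fibre not containing the centre has an even number of elements. -/
theorem sq_eq_mul (h : IsConePacking γ A B C D E F) (hγ : 0 ≤ γ) : B ^ 2 = A * C := by
  by_contra hΔ
  obtain ⟨p, hple, hp⟩ := Nat.exists_infinite_primes ((A * C - B ^ 2).natAbs + 3)
  have : Fact p.Prime := ⟨hp⟩
  have hΔp : ((A : ZMod p) * C - B ^ 2) ≠ 0 := by
    intro h0
    have h1 : ((A * C - B ^ 2 : ℤ) : ZMod p) = 0 := by push_cast; exact h0
    rw [ZMod.intCast_zmod_eq_zero_iff_dvd] at h1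
    have h2 := Int.natAbs_dvd_natAbs.mpr h1
    have h3 := Nat.le_of_dvd (Int.natAbs_pos.mpr (by omega)) h2
    simp only [Int.natAbs_natCast] at h3
    omega
  have h2p : (2 : ZMod p) ≠ 0 := by
    intro h0
    have h1 : ((2 : ℕ) : ZMod p) = 0 := by exact_mod_cast h0
    rw [ZMod.natCast_eq_zero_iff] at h1
    have := Nat.le_of_dvd (by norm_num) h1
    omega
  have hpodd : Odd p := hp.odd_of_ne_two (by omega)
  -- twice the polynomial has integer coefficients in the monomial basis
  set G : ZMod p × ZMod p → ZMod p := fun a =>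
    A * a.1 ^ 2 + 2 * B * a.1 * a.2 + C * a.2 ^ 2 + (2 * D - A) * a.1 + (2 * E - C) * a.2 + 2 * F
    with hG
  set s : ZMod p := (B * (2 * E - C) - C * (2 * D - A)) / ((A : ZMod p) * C - B ^ 2) with hs
  set t : ZMod p := (B * (2 * D - A) - A * (2 * E - C)) / ((A : ZMod p) * C - B ^ 2) with ht
  have hs' := div_mul_cancel₀ ((B : ZMod p) * (2 * E - C) - C * (2 * D - A)) hΔp
  have ht' := div_mul_cancel₀ ((B : ZMod p) * (2 * D - A) - A * (2 * E - C)) hΔp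
  rw [← hs] at hs'
  rw [← ht] at ht'
  have hcen1 : (A : ZMod p) * s + B * t = -(2 * D - A) := by
    refine mul_right_cancel₀ hΔp ?_
    linear_combination (A : ZMod p) * hs' + B * ht'
  have hcen2 : (B : ZMod p) * s + C * t = -(2 * E - C) := by
    refine mul_right_cancel₀ hΔp ?_
    linear_combination (B : ZMod p) * hs' + C * ht'
  have hrefl : ∀ a, G (s - a.1, t - a.2) = G a := by
    intro a
    simp only [hG]
    linear_combination (s - 2 * a.1) * hcen1 + (t - 2 * a.2) * hcen2
  set r : ZMod p := (G (s / 2, t / 2) + 1) / 2 with hr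
  have h2r : 2 * r = G (s / 2, t / 2) + 1 := by
    rw [hr]
    field_simp
  set Φ : Finset (ZMod p × ZMod p) := Finset.univ.filter fun a => G a = 2 * r with hΦ
  have heven : Even Φ.card := by
    refine even_card_of_involution Φ (fun a => (s - a.1, t - a.2)) (fun a ha => ?_)
      (fun a => by simp) (fun a ha hfix => ?_)
    · simp only [hΦ, Finset.mem_filter, Finset.mem_univ, true_and] at ha ⊢
      rw [hrefl, ha]
    · simp only [hΦ, Finset.mem_filter, Finset.mem_univ, true_and] at ha
      have h1 : s - a.1 = a.1 := congrArg Prod.fst hfix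
      have h2 : t - a.2 = a.2 := congrArg Prod.snd hfix
      have h3 : a = (s / 2, t / 2) := by
        ext
        · rw [eq_div_iff h2p]
          linear_combination -h1
        · rw [eq_div_iff h2p]
          linear_combination -h2
      rw [h2r, ← h3] at ha
      simp at ha
  have hne : Φ.card ≠ p := by
    intro he
    rw [he] at heven
    exact Nat.not_even_iff_odd.mpr hpodd heven
  obtain ⟨z, -, hz, hzn, -, -⟩ := h.exists_enum
  have hGz : ∀ n, G (((z n).1 : ZMod p), ((z n).2 : ZMod p)) = 2 * (n : ZMod p) := by
    intro n
    have h1 := hzn n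
    have h2 : A * (z n).1 ^ 2 + 2 * B * (z n).1 * (z n).2 + C * (z n).2 ^ 2
        + (2 * D - A) * (z n).1 + (2 * E - C) * (z n).2 + 2 * F = 2 * (n : ℤ) := by
      have : (A : ℝ) * (z n).1 ^ 2 + 2 * B * (z n).1 * (z n).2 + C * (z n).2 ^ 2
        + (2 * D - A) * (z n).1 + (2 * E - C) * (z n).2 + 2 * F = 2 * (n : ℝ) := by
        rw [← h1]
        simp only [quadVal]
        ring
      exact_mod_cast this
    have h3 := congrArg (Int.cast : ℤ → ZMod p) h2
    push_cast at h3
    exact h3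
  set q : ℝ := ((p : ℝ)) ^ 2 with hq
  have hp0 : (0 : ℝ) < p := by exact_mod_cast hp.pos
  have hq0 : 0 < q := by positivity
  have hcardq : (Fintype.card (ZMod p × ZMod p) : ℝ) = q := by
    rw [Fintype.card_prod, ZMod.card, hq]
    push_cast
    ring
  set c : ℕ → ZMod p × ZMod p → ℝ := fun N a => (((Finset.range N).filter fun n =>
    (((z n).1 : ZMod p), ((z n).2 : ZMod p)) = a).card : ℝ) with hc
  have hε : 0 < 1 / (2 * q ^ 2) := by positivity
  choose K hK0 hK using fun a b => h.exists_card_class_le hγ hz hzn p a b hε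
  set K' : ℝ := ∑ a, ∑ b, K a b with hK'
  have hKle : ∀ a b, K a b ≤ K' := fun a b =>
    (Finset.single_le_sum (f := fun b => K a b) (fun b _ => hK0 a b) (Finset.mem_univ b)).trans
      (Finset.single_le_sum (f := fun a => ∑ b, K a b)
        (fun a _ => Finset.sum_nonneg fun b _ => hK0 a b) (Finset.mem_univ a))
  have hcle : ∀ N a b, c N a ≤ c N b + (1 / (2 * q ^ 2) * N + K') := by
    intro N a b
    have h1 := hK a b N
    have h2 := hKle a b
    simp only [hc]
    linarith
  have htotal : ∀ N, ∑ a, c N a = N := by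
    intro N
    simp only [hc]
    rw [← Nat.cast_sum, ← Finset.card_eq_sum_card_fiberwise (fun _ _ => Finset.mem_univ _),
      Finset.card_range]
  have hfib : ∀ k : ℕ, ∑ a ∈ Φ, c (p * k) a = k := by
    intro k
    simp only [hc]
    rw [← Nat.cast_sum]
    congr 1
    refine Eq.trans ?_ (card_range_mul_filter_cast_eq r k)
    rw [Finset.card_eq_sum_card_fiberwise
      (f := fun n => (((z n).1 : ZMod p), ((z n).2 : ZMod p))) (t := Φ)]
    · refine Finset.sum_congr rfl fun a ha => ?_
      rw [Finset.filter_filter]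
      congr 1
      refine Finset.filter_congr fun n _ => ⟨fun hn => ⟨?_, hn⟩, fun hn => hn.2⟩
      simp only [hΦ, Finset.mem_filter, Finset.mem_univ, true_and] at ha
      rw [← hn, hGz] at ha
      exact mul_left_cancel₀ h2p ha
    · intro n hn
      simp only [Finset.coe_filter, Finset.mem_range, Set.mem_ofPred_eq] at hn
      simp only [hΦ, Finset.coe_filter, Finset.mem_univ, true_and, Set.mem_ofPred_eq]
      rw [hGz, hn.2]
  have hcardΦ : (Φ.card : ℝ) ≤ q := by
    rw [← hcardq]
    exact_mod_cast Finset.card_le_univ Φ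
  obtain ⟨k, hk⟩ := exists_nat_gt (2 * q ^ 2 * K' / p)
  rw [div_lt_iff₀ hp0] at hk
  set e : ℝ := 1 / (2 * q ^ 2) * (p * k : ℕ) + K' with he
  have hK'0 : 0 ≤ K' := Finset.sum_nonneg fun a _ => Finset.sum_nonneg fun b _ => hK0 a b
  have he0 : 0 ≤ e := by positivity
  have hub : q * (k : ℝ) ≤ Φ.card * (p * k : ℕ) + Φ.card * q * e := by
    have h1 : ∑ a ∈ Φ, ∑ _b : ZMod p × ZMod p, c (p * k) a
        ≤ ∑ _a ∈ Φ, ∑ b : ZMod p × ZMod p, (c (p * k) b + e) :=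
      Finset.sum_le_sum fun a _ => Finset.sum_le_sum fun b _ => hcle _ a b
    simp only [Finset.sum_const, Finset.sum_add_distrib, Finset.card_univ, nsmul_eq_mul,
      ← Finset.mul_sum, hfib, htotal, hcardq] at h1
    linarith
  have hlb : (Φ.card : ℝ) * (p * k : ℕ) ≤ q * k + Φ.card * q * e := by
    have h1 : ∑ _a ∈ Φ, ∑ b : ZMod p × ZMod p, c (p * k) b
        ≤ ∑ a ∈ Φ, ∑ _b : ZMod p × ZMod p, (c (p * k) a + e) :=
      Finset.sum_le_sum fun a _ => Finset.sum_le_sum fun b _ => hcle _ b a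
    simp only [Finset.sum_const, Finset.sum_add_distrib, Finset.card_univ, nsmul_eq_mul,
      ← Finset.mul_sum, hfib, htotal, hcardq] at h1
    linarith
  have hqe : (Φ.card : ℝ) * q * e ≤ q ^ 2 * e := by
    rw [sq]
    exact mul_le_mul_of_nonneg_right (mul_le_mul_of_nonneg_right hcardΦ hq0.le) he0
  have hqe' : q ^ 2 * e = p * k / 2 + q ^ 2 * K' := by
    rw [he]
    push_cast
    field_simp
  have hpk : (0 : ℝ) ≤ p * k := by positivity
  push_cast at hub hlb
  rcases lt_or_gt_of_ne hne with hlt | hgt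
  · have h1 : (Φ.card : ℝ) + 1 ≤ p := by exact_mod_cast hlt
    nlinarith
  · have h1 : (p : ℝ) + 1 ≤ Φ.card := by exact_mod_cast hgt
    nlinarith

end IsConePacking

/-! ### The area of the level triangles -/

/-- The lattice points of the cone below a level line of `A x + B y`, counted row by row. -/
theorem exists_triangle_finset {γ A B : ℝ} (hA : 0 < A) (hl : 0 < A * γ + B) (n : ℕ) :
    ∃ T : Finset (ℤ × ℤ),
      (∀ p, p ∈ T ↔ p ∈ coneLattice γ ∧ A * p.1 + B * p.2 ≤ (A * γ + B) * n) ∧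
      (A * γ + B) / (2 * A) * (n * (n + 1)) - (n + 1) ≤ T.card ∧
      T.card ≤ (A * γ + B) / (2 * A) * (n * (n + 1)) + (n + 1) := by
  set l : ℝ := A * γ + B with hldef
  set R : ℕ → Finset ℤ := fun j => Finset.Icc ⌈γ * j⌉ ⌊(l * n - B * j) / A⌋ with hR
  set T₀ : Finset (Σ _ : ℕ, ℤ) := (Finset.range (n + 1)).sigma R with hT₀
  set ι : (Σ _ : ℕ, ℤ) → ℤ × ℤ := fun a => (a.2, (a.1 : ℤ)) with hι
  have hinj : Function.Injective ι := by
    rintro ⟨a, b⟩ ⟨a', b'⟩ hab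
    simp only [hι, Prod.mk.injEq] at hab
    obtain ⟨h1, h2⟩ := hab
    have h3 : a = a' := by exact_mod_cast h2
    subst h3; subst h1; rfl
  have hmemR : ∀ (j : ℕ) (x : ℤ), x ∈ R j ↔ γ * j ≤ x ∧ A * x + B * j ≤ l * n := by
    intro j x
    simp only [hR, Finset.mem_Icc, Int.ceil_le, Int.le_floor, le_div_iff₀ hA]
    refine and_congr Iff.rfl ⟨fun h => by linarith, fun h => by linarith⟩
  have hcard : ((T₀.image ι).card : ℝ) = ∑ j ∈ Finset.range (n + 1), ((R j).card : ℝ) := by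
    rw [Finset.card_image_of_injective _ hinj, hT₀, Finset.card_sigma, Nat.cast_sum]
  have hsum : ∑ j ∈ Finset.range (n + 1), l / A * ((n : ℝ) - j)
      = l / (2 * A) * (n * (n + 1)) := by
    have h1 : ∑ j ∈ Finset.range (n + 1), (j : ℝ) = n * (n + 1) / 2 := by
      have := Finset.sum_range_id_mul_two (n + 1)
      rw [Nat.add_sub_cancel] at this
      have h2 := congrArg (Nat.cast : ℕ → ℝ) this
      push_cast at h2
      linarith
    rw [← Finset.mul_sum, Finset.sum_sub_distrib, h1]
    simp only [Finset.sum_const, Finset.card_range, nsmul_eq_mul]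
    push_cast
    field_simp
    ring
  have hrow : ∀ j ∈ Finset.range (n + 1),
      l / A * ((n : ℝ) - j) - 1 ≤ (R j).card ∧ ((R j).card : ℝ) ≤ l / A * ((n : ℝ) - j) + 1 := by
    intro j hj
    have hjn : (j : ℝ) ≤ n := by
      exact_mod_cast Nat.lt_succ_iff.mp (Finset.mem_range.mp hj)
    have hnn : 0 ≤ l / A * ((n : ℝ) - j) := mul_nonneg (by positivity) (by linarith)
    have heq : (l * n - B * j) / A - γ * j = l / A * ((n : ℝ) - j) := by
      rw [hldef]
      field_simp
      ring
    have f1 := Int.floor_le ((l * n - B * j) / A)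
    have f2 := Int.lt_floor_add_one ((l * n - B * j) / A)
    have f3 := Int.le_ceil (γ * j)
    have f4 := Int.ceil_lt_add_one (γ * j)
    have hc : (((R j).card : ℤ) : ℝ)
        = max ((⌊(l * n - B * j) / A⌋ : ℝ) + 1 - ⌈γ * j⌉) 0 := by
      simp only [hR, Int.card_Icc, Int.toNat_eq_max]
      push_cast
      rfl
    rw [Int.cast_natCast] at hc
    rw [hc]
    refine ⟨le_max_of_le_left (by linarith), max_le (by linarith) (by linarith)⟩
  refine ⟨T₀.image ι, fun p => ?_, ?_, ?_⟩
  · rw [Finset.mem_image]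
    constructor
    · rintro ⟨⟨j, x⟩, hjx, rfl⟩
      rw [hT₀, Finset.mem_sigma] at hjx
      have h1 := (hmemR j x).mp hjx.2
      exact ⟨⟨by simp [hι], by simpa [hι] using h1.1⟩, by simpa [hι] using h1.2⟩
    · rintro ⟨⟨hp1, hp2⟩, hp3⟩
      obtain ⟨x, y⟩ := p
      simp only at hp1 hp2 hp3
      obtain ⟨j, rfl⟩ := Int.eq_ofNat_of_zero_le hp1
      simp only [Int.cast_natCast] at hp2 hp3
      refine ⟨⟨j, x⟩, ?_, rfl⟩
      rw [hT₀, Finset.mem_sigma]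
      refine ⟨?_, (hmemR j x).mpr ⟨hp2, hp3⟩⟩
      have h1 : l * j ≤ l * n := by
        rw [hldef] at hp3 ⊢
        nlinarith
      have h2 : j ≤ n := by exact_mod_cast le_of_mul_le_mul_left h1 hl
      exact Finset.mem_range.mpr (Nat.lt_succ_of_le h2)
  · rw [hcard, ← hsum]
    have := Finset.sum_le_sum fun j hj => (hrow j hj).1
    rw [Finset.sum_sub_distrib] at this
    simpa using this
  · rw [hcard, ← hsum]
    have := Finset.sum_le_sum fun j hj => (hrow j hj).2
    rw [Finset.sum_add_distrib] at this
    simpa using this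

namespace IsConePacking

variable {γ : ℝ} {A B C D E F : ℤ}

/-- In the degenerate case the points with value at most `N` fill, up to lower order, the
triangle cut from the cone by `A x + B y ≤ √(2 A N)`, whose area is `N / (A γ + B)`. Since there
are `N + 1` of them, `A γ + B = 1`. -/
theorem edge_eq_one (h : IsConePacking γ A B C D E F) (hγ : 0 ≤ γ) :
    (A : ℝ) * γ + B = 1 := by
  have hΔ := h.sq_eq_mul hγ
  have hA : (0 : ℝ) < A := by exact_mod_cast h.A_pos
  have hl : 0 < (A : ℝ) * γ + B := by
    have := h.neg_B_lt hΔ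
    linarith
  set l : ℝ := (A : ℝ) * γ + B with hldef
  set c₂ : ℝ := D - A / 2 with hc₂
  set c₃ : ℝ := E - C / 2 with hc₃
  set κ : ℝ := |c₂| * (1 / A + γ / l) + |c₃| / l with hκ
  have hκ0 : 0 ≤ κ := by positivity
  have hval : ∀ p ∈ coneLattice γ, ∃ L : ℝ, L = A * p.1 + B * p.2 ∧ 0 ≤ L ∧
      |quadVal A B C D E F p.1 p.2 - L ^ 2 / (2 * A)| ≤ κ * L + |(F : ℝ)| := by
    intro p hp
    have hx : (0 : ℝ) ≤ p.1 := fst_nonneg_of_mem_coneLattice hγ hp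
    have hy : (0 : ℝ) ≤ p.2 := by exact_mod_cast hp.1
    have hxy := hp.2
    have hΔ' : (B : ℝ) ^ 2 = A * C := by exact_mod_cast hΔ
    set x : ℝ := (p.1 : ℝ)
    set y : ℝ := (p.2 : ℝ)
    obtain ⟨L, hL⟩ : ∃ L : ℝ, L = A * x + B * y := ⟨_, rfl⟩
    have hL' : L = A * (x - γ * y) + l * y := by rw [hL, hldef]; ring
    have h1 : 0 ≤ A * (x - γ * y) := mul_nonneg hA.le (by linarith)
    have h2 : 0 ≤ l * y := by positivity
    have hy' : y ≤ L / l := by rw [le_div_iff₀ hl]; linarith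
    have hx' : x ≤ L * (1 / A + γ / l) := by
      have h3 : x - γ * y ≤ L / A := by rw [le_div_iff₀ hA]; linarith
      have h4 := mul_le_mul_of_nonneg_left hy' hγ
      have h5 : L * (1 / A + γ / l) = L / A + γ * (L / l) := by ring
      linarith
    refine ⟨L, hL, by linarith, ?_⟩
    have heq : quadVal A B C D E F x y - L ^ 2 / (2 * A) = c₂ * x + c₃ * y + F := by
      simp only [quadVal, hc₂, hc₃, hL]
      field_simp
      linear_combination (-(y ^ 2)) * hΔ'
    rw [heq]
    calc |c₂ * x + c₃ * y + F| ≤ |c₂ * x| + |c₃ * y| + |(F : ℝ)| := abs_add_three _ _ _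
      _ = |c₂| * x + |c₃| * y + |(F : ℝ)| := by
          rw [abs_mul, abs_mul, abs_of_nonneg hx, abs_of_nonneg hy]
      _ ≤ |c₂| * (L * (1 / A + γ / l)) + |c₃| * (L / l) + |(F : ℝ)| := by gcongr
      _ = κ * L + |(F : ℝ)| := by rw [hκ]; ring
  have hupper : ∀ n : ℕ, 0 ≤ n →
      (l - l ^ 2) / (2 * A) * n ^ 2 ≤ (κ * l + 1 - l / (2 * A)) * n + (|(F : ℝ)| + 2) := by
    intro n _
    obtain ⟨T, hT, hlow, -⟩ := exists_triangle_finset hA hl n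
    have h1 := h.card_le T (fun p hp => ((hT p).mp hp).1)
      (N := (l * n) ^ 2 / (2 * A) + κ * (l * n) + |(F : ℝ)|) (by positivity) (fun p hp => by
        obtain ⟨hp1, hp2⟩ := (hT p).mp hp
        obtain ⟨L, hL, hL0, hLb⟩ := hval p hp1
        rw [← hL] at hp2
        have h3 : L ^ 2 / (2 * A) ≤ (l * n) ^ 2 / (2 * A) := by gcongr
        have h4 : κ * L ≤ κ * (l * n) := by gcongr
        linarith [(abs_le.mp hLb).2])
    have h2 : (l - l ^ 2) / (2 * A) * n ^ 2
        = l / (2 * A) * (n * (n + 1)) - (l * n) ^ 2 / (2 * A) - l / (2 * A) * n := by ring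
    rw [h2]
    linarith
  have hlower : ∀ n : ℕ, ⌈A * κ / l⌉₊ ≤ n →
      (l ^ 2 - l) / (2 * A) * n ^ 2 ≤ (κ * l + 1 + l / (2 * A)) * n + (|(F : ℝ)| + 1) := by
    intro n hn
    have hn' : A * κ ≤ l * n := by
      have h1 : A * κ / l ≤ n := (Nat.le_ceil _).trans (by exact_mod_cast hn)
      rw [div_le_iff₀ hl] at h1
      linarith
    obtain ⟨T, hT, -, hup⟩ := exists_triangle_finset hA hl n
    obtain ⟨z, -, hz, hzn, -, -⟩ := h.exists_enum
    set X : ℝ := (l * n) ^ 2 / (2 * A) - κ * (l * n) - |(F : ℝ)| with hX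
    have h1 : (Finset.range ⌈X⌉₊).card ≤ T.card := by
      refine Finset.card_le_card_of_injOn z (fun m hm => ?_) (fun m _ m' _ hmm => ?_)
      · have hmX : (m : ℝ) < X := Nat.lt_ceil.mp (Finset.mem_range.mp hm)
        refine (hT _).mpr ⟨hz m, ?_⟩
        by_contra! hout
        obtain ⟨L, hL, hL0, hLb⟩ := hval _ (hz m)
        rw [← hL] at hout
        rw [hzn] at hLb
        have h3 := (abs_le.mp hLb).1
        -- `L ^ 2 / (2 A) - κ L` increases for `L ≥ A κ`
        have h4 : (l * n) ^ 2 / (2 * A) - κ * (l * n) ≤ L ^ 2 / (2 * A) - κ * L := by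
          have h5 : (L ^ 2 / (2 * A) - κ * L) - ((l * n) ^ 2 / (2 * A) - κ * (l * n))
              = (L - l * n) * ((L + l * n) - 2 * (A * κ)) / (2 * A) := by
            field_simp
            ring
          have h6 : 0 ≤ (L - l * n) * ((L + l * n) - 2 * (A * κ)) / (2 * A) :=
            div_nonneg (mul_nonneg (by linarith) (by linarith)) (by linarith)
          linarith
        linarith
      · have h4 := hzn m
        rw [hmm, hzn m'] at h4
        exact_mod_cast h4.symm
    rw [Finset.card_range] at h1
    have h2 : X ≤ T.card := (Nat.le_ceil X).trans (by exact_mod_cast h1)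
    have h3 : (l ^ 2 - l) / (2 * A) * n ^ 2
        = (l * n) ^ 2 / (2 * A) - l / (2 * A) * (n * (n + 1)) + l / (2 * A) * n := by ring
    rw [h3]
    linarith
  have h1 := nonpos_of_forall_mul_sq_le hupper
  have h2 := nonpos_of_forall_mul_sq_le hlower
  rw [div_le_iff₀ (by positivity), zero_mul] at h1 h2
  have h3 : l * (l - 1) = 0 := by linarith
  rcases mul_eq_zero.mp h3 with h4 | h4
  · exact absurd h4 hl.ne'
  · linarith

end IsConePacking

/-! ### Coefficients of a packing polynomial -/

theorem exists_polyValue_eq_of_totalDegree_le_two (P : MvPolynomial (Fin 2) ℝ)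
    (hP : P.totalDegree ≤ 2) :
    ∃ a b c d e f : ℝ, ∀ x y : ℝ,
      polyValue P x y = a * x ^ 2 + b * x * y + c * y ^ 2 + d * x + e * y + f := by
  have key : ∀ s : Finset (Fin 2 →₀ ℕ), (∀ m ∈ s, m 0 + m 1 ≤ 2) →
      ∃ a b c d e f : ℝ, ∀ x y : ℝ, ∑ m ∈ s, P.coeff m * (x ^ m 0 * y ^ m 1)
        = a * x ^ 2 + b * x * y + c * y ^ 2 + d * x + e * y + f := by
    intro s
    induction s using Finset.induction_on with
    | empty => exact fun _ => ⟨0, 0, 0, 0, 0, 0, fun x y => by simp⟩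
    | insert m s hm ih =>
      intro hs
      obtain ⟨a, b, c, d, e, f, h⟩ := ih fun m' hm' => hs m' (Finset.mem_insert_of_mem hm')
      have h2 := hs m (Finset.mem_insert_self m s)
      simp only [Finset.sum_insert hm, h]
      generalize P.coeff m = w
      generalize m 0 = i at h2
      generalize m 1 = j at h2
      have hi : i ≤ 2 := by omega
      have hj : j ≤ 2 := by omega
      interval_cases i <;> interval_cases j
      · exact ⟨a, b, c, d, e, f + w, fun x y => by ring⟩
      · exact ⟨a, b, c, d, e + w, f, fun x y => by ring⟩
      · exact ⟨a, b, c + w, d, e, f, fun x y => by ring⟩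
      · exact ⟨a, b, c, d + w, e, f, fun x y => by ring⟩
      · exact ⟨a, b + w, c, d, e, f, fun x y => by ring⟩
      · omega
      · exact ⟨a + w, b, c, d, e, f, fun x y => by ring⟩
      · omega
      · omega
  obtain ⟨a, b, c, d, e, f, h⟩ := key P.support fun m hm => by
    have := (MvPolynomial.le_totalDegree hm).trans hP
    rwa [Finsupp.sum_fintype _ _ (fun _ => rfl), Fin.sum_univ_two] at this
  refine ⟨a, b, c, d, e, f, fun x y => ?_⟩
  rw [← h, polyValue, MvPolynomial.eval_eq']
  simp [Fin.prod_univ_two]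

/-- A quadratic polynomial with integer values on the lattice points of a cone has integer
coefficients in the binomial basis: they are finite differences at a point of the cone. -/
theorem exists_hasIntegerForm {γ : ℝ} (P : MvPolynomial (Fin 2) ℝ)
    (hP : P.totalDegree ≤ 2)
    (hint : ∀ p ∈ coneLattice γ, ∃ n : ℤ, polyValue P (p.1 : ℝ) (p.2 : ℝ) = n) :
    ∃ A B C D E F : ℤ, HasIntegerForm P A B C D E F := by
  obtain ⟨a, b, c, d, e, f, h⟩ := exists_polyValue_eq_of_totalDegree_le_two P hP
  -- all points `(k, j)` with `k ≥ N` and `0 ≤ j ≤ 2` lie in the cone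
  set N : ℕ := ⌈2 * |γ|⌉₊ with hN
  have hmem : ∀ i j : ℕ, j ≤ 2 → ((N + i, j) : ℤ × ℤ) ∈ coneLattice γ := by
    intro i j hj
    refine ⟨by positivity, ?_⟩
    push_cast
    have h1 := Nat.le_ceil (2 * |γ|)
    have h2 : (j : ℝ) ≤ 2 := by exact_mod_cast hj
    have h3 : γ * j ≤ |γ| * j :=
      mul_le_mul_of_nonneg_right (le_abs_self γ) (Nat.cast_nonneg j)
    have h4 := mul_le_mul_of_nonneg_left h2 (abs_nonneg γ)
    have h5 : (0 : ℝ) ≤ i := Nat.cast_nonneg i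
    linarith
  have hv : ∀ i j : ℕ, j ≤ 2 → ∃ n : ℤ, a * ((N : ℝ) + i) ^ 2 + b * (N + i) * j + c * j ^ 2
      + d * (N + i) + e * j + f = n := by
    intro i j hj
    obtain ⟨n, hn⟩ := hint _ (hmem i j hj)
    rw [h] at hn
    push_cast at hn
    exact ⟨n, hn⟩
  obtain ⟨n00, h00⟩ := hv 0 0 (by norm_num)
  obtain ⟨n10, h10⟩ := hv 1 0 (by norm_num)
  obtain ⟨n20, h20⟩ := hv 2 0 (by norm_num)
  obtain ⟨n01, h01⟩ := hv 0 1 (by norm_num)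
  obtain ⟨n11, h11⟩ := hv 1 1 (by norm_num)
  obtain ⟨n02, h02⟩ := hv 0 2 (by norm_num)
  push_cast at h00 h10 h20 h01 h11 h02
  obtain ⟨A, hA⟩ : ∃ A : ℤ, 2 * a = A := ⟨n20 - 2 * n10 + n00, by push_cast; linarith⟩
  obtain ⟨B, hB⟩ : ∃ B : ℤ, b = B := ⟨n11 - n10 - n01 + n00, by push_cast; linarith⟩
  obtain ⟨C, hC⟩ : ∃ C : ℤ, 2 * c = C := ⟨n02 - 2 * n01 + n00, by push_cast; linarith⟩
  obtain ⟨D, hD⟩ : ∃ D : ℤ, d + a = D := ⟨n10 - n00 - A * N, by push_cast; rw [← hA]; linarith⟩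
  obtain ⟨E, hE⟩ : ∃ E : ℤ, e + c = E := ⟨n01 - n00 - B * N, by push_cast; rw [← hB]; linarith⟩
  obtain ⟨F, hF⟩ : ∃ F : ℤ, a * (N : ℝ) ^ 2 - a * N + f = F :=
    ⟨n00 - D * N, by push_cast; rw [← hD]; linarith⟩
  -- `N ^ 2 - N` is even, so `a (N ^ 2 - N)` is an integer
  obtain ⟨F', hF'⟩ : ∃ F' : ℤ, f = F' := by
    obtain ⟨k, hk⟩ : ∃ k : ℤ, (N : ℤ) * (N - 1) = 2 * k := by
      have := Int.even_mul_pred_self (N : ℤ)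
      obtain ⟨k, hk⟩ := this
      exact ⟨k, by omega⟩
    have hk' : (N : ℝ) * (N - 1) = 2 * k := by exact_mod_cast hk
    refine ⟨F - A * k, ?_⟩
    push_cast
    rw [← hA, ← hF]
    linear_combination (-a) * hk'
  refine ⟨A, B, C, D, E, F', fun x y => ?_⟩
  rw [h, ← hA, ← hB, ← hC, ← hD, ← hE, ← hF']
  ring

/-- A packing polynomial of degree at most two has integer coefficients in the binomial basis and
packs the cone in this form. -/
theorem exists_isConePacking {γ : ℝ} {S : Set (ℝ × ℝ)} (P : MvPolynomial (Fin 2) ℝ)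
    (hP : P.totalDegree ≤ 2) (hS : latticePoints S = coneLattice γ)
    (hpack : IsPackingPolynomial P S) :
    ∃ A B C D E F : ℤ, HasIntegerForm P A B C D E F ∧ IsConePacking γ A B C D E F := by
  rw [IsPackingPolynomial, hS] at hpack
  obtain ⟨A, B, C, D, E, F, h⟩ := exists_hasIntegerForm P hP (γ := γ) fun p hp => by
    obtain ⟨n, hn⟩ := hpack.mapsTo hp
    exact ⟨n, by rw [Int.cast_natCast]; exact hn.symm⟩
  exact ⟨A, B, C, D, E, F, h, hpack.congr fun p _ => h p.1 p.2⟩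

theorem latticePoints_sector {α : ℝ} (hα : 0 < α) :
    latticePoints (sector α) = coneLattice (1 / α) := by
  ext p
  simp only [latticePoints, sector, coneLattice, Set.mem_ofPred_eq, Int.cast_nonneg_iff,
    one_div_mul_eq_div, div_le_iff₀' hα]

theorem latticePoints_firstQuadrant : latticePoints firstQuadrant = coneLattice 0 := by
  ext p
  simp only [latticePoints, firstQuadrant, coneLattice, Set.mem_ofPred_eq, Int.cast_nonneg_iff,
    zero_mul, and_comm]

theorem theorem2 (P : MvPolynomial (Fin 2) ℝ) (hdeg : P.totalDegree = 2) :
    (∀ α : ℝ, 0 < α → IsPackingPolynomial P (sector α) →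
      ∃ A B C D E F : ℤ, HasIntegerForm P A B C D E F ∧
        B ≠ 1 ∧ α = (A : ℝ) / (1 - (B : ℝ))) ∧
    (IsPackingPolynomial P firstQuadrant →
      ∃ A B C D E F : ℤ, HasIntegerForm P A B C D E F ∧
        0 < A ∧ B = 1) := by
  refine ⟨fun α hα hpack => ?_, fun hpack => ?_⟩
  · obtain ⟨A, B, C, D, E, F, hform, h⟩ :=
      exists_isConePacking P hdeg.le (latticePoints_sector hα) hpack
    have hA : (0 : ℝ) < A := by exact_mod_cast h.A_pos
    have h1 := h.edge_eq_one (by positivity)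
    have h2 : (A : ℝ) = α * (1 - B) := by
      rw [← h1]
      field_simp
      ring
    have hB : (1 : ℝ) - B ≠ 0 := by
      intro h0
      rw [h0, mul_zero] at h2
      exact hA.ne' h2
    refine ⟨A, B, C, D, E, F, hform, ?_, ?_⟩
    · rintro rfl
      simp at hB
    · rw [eq_div_iff hB, h2]
  · obtain ⟨A, B, C, D, E, F, hform, h⟩ :=
      exists_isConePacking P hdeg.le latticePoints_firstQuadrant hpack
    have h1 := h.edge_eq_one le_rfl
    rw [mul_zero, zero_add] at h1
    exact ⟨A, B, C, D, E, F, hform, h.A_pos, by exact_mod_cast h1⟩
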